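/- Let $\mathcal T=(\mathcal V,\mathcal E,\ell)$ be a finite tree with root $r\in\mathcal V$ and edge lengths $\ell:\mathcal E\to(0,\infty)$, and let $\mathcal E_r$ be the set of its edges directed away from $r$; for $e=(u,v)\in\mathcal E_r$ write $s(e)=u$ and $T^e=\ell(e)$. Regard $\mathcal T$ also as the continuous space obtained by replacing each $e=(u,v)\in\mathcal E_r$ by a segment $[0,T^e]$ whose ends $0$ and $T^e$ are glued to $u$ and $v$. Let $\mathcal C_{\mathcal T}=C(\mathcal T,\mathbb R^d)$ be the space of continuous paths with the Borel $\sigma$-algebra of the compact-open topology. For $X\in\mathcal C_{\mathcal T}$ let $X_v\in\mathbb R^d$ be its value at the vertex $v$ and $X^e\in C([0,T^e],\mathbb R^d)$ its restriction to the edge $e$. For a probability measure $\mathbb P$ on $\mathcal C_{\mathcal T}$, let $\mathbb P_v$ be the law of $X_v$ under $\mathbb P$, and let $\mathbb P^{(u,v)}(\cdot\mid X_u)$ be the regular conditional law of $X^{(u,v)}$ given $X_u$ under $\mathbb P$. Fix an enumeration $e_1,\dots,e_K$ of $\mathcal E_r$ in which the edge entering a vertex always precedes the edges leaving it (for example, a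 depth-first ordering). Say that $\mathbb P$ factorises along the tree if, for every $k$, $\mathbb P$-almost surely $$\mathbb P\big(X^{e_k}\in\cdot\mid X_r,X^{e_1},\dots,X^{e_{k-1}}\big)=\mathbb P^{e_k}\big(\cdot\mid X_{s(e_k)}\big).$$ Let $\mathbb P,\tilde{\mathbb P}$ be probability measures on $\mathcal C_{\mathcal T}$ that both factorise along the tree and share the root marginal, $\mathbb P_r=\tilde{\mathbb P}_r$. Then, as an identity in $[0,\infty]$, $$\mathrm{KL}(\mathbb P\,\Vert\,\tilde{\mathbb P})=\sum_{(u,v)\in\mathcal E_r}\mathbb E_{X_u\sim\mathbb P_u}\Big[\mathrm{KL}\big(\mathbb P^{(u,v)}(\cdot\mid X_u)\,\Vert\,\tilde{\mathbb P}^{(u,v)}(\cdot\mid X_u)\big)\Big],$$ where each function inside an expectation is a measurable function of $X_u$ with values in $[0,\infty]$. -/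

import Mathlib

open MeasureTheory ProbabilityTheory InformationTheory
open scoped ENNReal

noncomputable section

/-- Spaces of continuous maps carry the compact-open topology and its Borel sigma-algebra. -/
instance ContinuousMap.instMeasurableSpaceBorel {X Y : Type*} [TopologicalSpace X]
    [TopologicalSpace Y] : MeasurableSpace C(X, Y) :=
  borel C(X, Y)

instance ContinuousMap.instBorelSpaceBorel {X Y : Type*} [TopologicalSpace X]
    [TopologicalSpace Y] : BorelSpace C(X, Y) :=
  ⟨rfl⟩

/-- A tree with vertex set `V`, a root, and a positive length attached to every edge. -/
structure RootedMetricTree (V : Type*) where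
  /-- the underlying graph -/
  graph : SimpleGraph V
  isTree : graph.IsTree
  /-- the root -/
  root : V
  /-- the edge-length function -/
  length : graph.edgeSet → ℝ
  length_pos : ∀ e, 0 < length e

namespace RootedMetricTree

variable {V : Type*}

/-- The directed edges `(u, v)`: the edges of the tree, oriented away from the root. -/
def DirEdge (T : RootedMetricTree V) : Type _ :=
  {p : V × V // T.graph.Adj p.1 p.2 ∧
    T.graph.dist T.root p.2 = T.graph.dist T.root p.1 + 1}

instance (T : RootedMetricTree V) [Finite V] : Finite T.DirEdge :=
  inferInstanceAs (Finite {p : V × V // _})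

instance (T : RootedMetricTree V) [Finite V] : Fintype T.DirEdge :=
  Fintype.ofFinite _

namespace DirEdge

variable {T : RootedMetricTree V}

/-- The starting vertex `u` of a directed edge `(u, v)`. -/
def src (e : T.DirEdge) : V := e.1.1

/-- The final vertex `v` of a directed edge `(u, v)`. -/
def tgt (e : T.DirEdge) : V := e.1.2

/-- The length `T^e` of a directed edge. -/
def len (e : T.DirEdge) : ℝ :=
  T.length ⟨s(e.src, e.tgt), (SimpleGraph.mem_edgeSet T.graph).2 e.2.1⟩

theorem len_pos (e : T.DirEdge) : 0 < e.len := T.length_pos _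

/-- The time interval `[0, T^e]` of a directed edge. -/
abbrev Interval (e : T.DirEdge) : Type := Set.Icc (0 : ℝ) e.len

/-- The time `0`. -/
def start (e : T.DirEdge) : e.Interval := ⟨0, le_rfl, e.len_pos.le⟩

/-- The time `T^e`. -/
def finish (e : T.DirEdge) : e.Interval := ⟨e.len, e.len_pos.le, le_rfl⟩

end DirEdge

/-- The disjoint union of the vertices and of the intervals `[0, T^e]`. -/
def Pieces (T : RootedMetricTree V) : Type _ :=
  V ⊕ (Σ e : T.DirEdge, e.Interval)

/-- The disjoint union topology, the vertices being discrete. -/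
instance (T : RootedMetricTree V) : TopologicalSpace T.Pieces :=
  letI : TopologicalSpace V := ⊥
  inferInstanceAs (TopologicalSpace (V ⊕ (Σ e : T.DirEdge, e.Interval)))

/-- The two ends of the interval of `(u, v)` are glued to `u` and to `v`. -/
inductive Glue (T : RootedMetricTree V) : T.Pieces → T.Pieces → Prop
  | src (e : T.DirEdge) : Glue T (Sum.inl e.src) (Sum.inr ⟨e, e.start⟩)
  | tgt (e : T.DirEdge) : Glue T (Sum.inl e.tgt) (Sum.inr ⟨e, e.finish⟩)

/-- The tree as a continuous space, in which every edge is a segment, with the quotient topology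
(for a finite tree this is the topology of the length metric). -/
def Realisation (T : RootedMetricTree V) : Type _ := Quot T.Glue

instance (T : RootedMetricTree V) : TopologicalSpace T.Realisation :=
  inferInstanceAs (TopologicalSpace (Quot T.Glue))

/-- A vertex as a point of the continuous tree. -/
def vertexPoint (T : RootedMetricTree V) (v : V) : T.Realisation :=
  Quot.mk _ (Sum.inl v)

/-- The segment of the continuous tree that corresponds to an edge, run through from its starting
vertex to its final vertex. -/
def edgePath (T : RootedMetricTree V) (e : T.DirEdge) : C(e.Interval, T.Realisation) where
  toFun t := Quot.mk _ (Sum.inr ⟨e, t⟩)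
  continuous_toFun :=
    letI : TopologicalSpace V := ⊥
    continuous_quot_mk.comp (continuous_inr.comp continuous_sigmaMk)

/-- The space of continuous paths from the tree into `ℝ^d`. -/
abbrev PathSpace (T : RootedMetricTree V) (d : ℕ) : Type _ :=
  C(T.Realisation, EuclideanSpace ℝ (Fin d))

/-- The space of continuous paths `[0, T^e] → ℝ^d`. -/
abbrev EdgePathSpace {T : RootedMetricTree V} (e : T.DirEdge) (d : ℕ) : Type :=
  C(e.Interval, EuclideanSpace ℝ (Fin d))

variable {T : RootedMetricTree V} {d : ℕ}

/-- The value `X_v` at a vertex. -/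
def vertexValue (v : V) (X : T.PathSpace d) : EuclideanSpace ℝ (Fin d) :=
  X (T.vertexPoint v)

/-- The process `X^e = (X^e_t)` for `0 ≤ t ≤ T^e` along an edge. -/
def edgeProcess (e : T.DirEdge) (X : T.PathSpace d) : EdgePathSpace e d :=
  X.comp (T.edgePath e)

/-- The conditional law `P^{(u,v)}(· | X_u = x)` of the process along `(u, v)`, as a kernel
in `x`. -/
def edgeKernel (P : Measure (T.PathSpace d)) [IsFiniteMeasure P] (e : T.DirEdge) :
    Kernel (EuclideanSpace ℝ (Fin d)) (EdgePathSpace e d) :=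
  condDistrib (edgeProcess e) (vertexValue e.src) P

/-- An enumeration `σ 0, σ 1, …` of the directed edges is a traversal of the tree if the edge that
enters a vertex always comes before the edges that leave it (as in a depth-first traversal). -/
def IsTraversal {n : ℕ} (σ : Fin n ≃ T.DirEdge) : Prop :=
  ∀ i j : Fin n, (σ i).tgt = (σ j).src → i < j

/-- The value at the root, together with the processes along the edges that precede `σ k`. -/
def past {n : ℕ} (σ : Fin n ≃ T.DirEdge) (k : Fin n) (X : T.PathSpace d) :
    EuclideanSpace ℝ (Fin d) × (∀ j : {j : Fin n // j < k}, EdgePathSpace (σ j) d) :=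
  (vertexValue T.root X, fun j => edgeProcess (σ j) X)

/-- `P` factorises along the tree: almost surely, the conditional law of the process along each
edge, given the root value and the processes along all preceding edges, is its conditional law
given the value at the starting vertex of the edge alone. -/
def Factorises {n : ℕ} (σ : Fin n ≃ T.DirEdge) (P : Measure (T.PathSpace d))
    [IsFiniteMeasure P] : Prop :=
  ∀ k : Fin n, ∀ᵐ X ∂P,
    condDistrib (edgeProcess (σ k)) (past σ k) P (past σ k X) =
      edgeKernel P (σ k) (vertexValue (σ k).src X)

end RootedMetricTree

end

/-! The proof is the chain rule for relative entropy, applied one edge at a time. The joint law of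
the past and of the process along the next edge is the law of the past composed with a conditional
kernel. Factorisation makes that kernel, under both measures, depend on the past only through the
value at the edge's source, so each edge adds its expected conditional divergence
(`klDiv_map_prodMk`). The common root law makes the initial divergence zero. After all edges the
past determines the path measurably (`measurableEmbedding_pastUpTo`), so no divergence is lost.
Every step holds in `[0, ∞]`, so no finiteness or absolute continuity is assumed. -/

namespace InformationTheory

/-! ### Conditional divergence of kernels -/

section Kernel

variable {α β : Type*} {mα : MeasurableSpace α} {mβ : MeasurableSpace β}
  [MeasurableSpace.CountableOrCountablyGenerated α β]

/-- The divergence of two finite kernels, in terms of their jointly measurable density. -/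
theorem klDiv_kernel_eq_lintegral (κ η : Kernel α β) [IsFiniteKernel κ] [IsFiniteKernel η] {a : α}
    (h : κ a ≪ η a) :
    klDiv (κ a) (η a) = ∫⁻ b, ENNReal.ofReal (klFun (κ.rnDeriv η a b).toReal) ∂(η a) := by
  rw [klDiv_eq_lintegral_klFun_of_ac h]
  refine lintegral_congr_ae ?_
  filter_upwards [Kernel.rnDeriv_eq_rnDeriv_measure (κ := κ) (η := η) (a := a)] with b hb
  rw [hb]

theorem measurable_ofReal_klFun_rnDeriv (κ η : Kernel α β) :
    Measurable fun p : α × β => ENNReal.ofReal (klFun (κ.rnDeriv η p.1 p.2).toReal) :=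
  (measurable_klFun.comp (Kernel.measurable_rnDeriv κ η).ennreal_toReal).ennreal_ofReal

/-- The divergence of two finite kernels is a measurable function of the parameter. -/
theorem measurable_klDiv_kernel (κ η : Kernel α β) [IsFiniteKernel κ] [IsFiniteKernel η] :
    Measurable fun a => klDiv (κ a) (η a) := by
  classical
  -- The density of the kernels is jointly measurable, and the parameters with `κ a ≪ η a` form a
  -- measurable set, off which the divergence is `∞`.
  have key : (fun a => klDiv (κ a) (η a)) = fun a => if κ a ≪ η a then
      ∫⁻ b, ENNReal.ofReal (klFun (κ.rnDeriv η a b).toReal) ∂(η a) else ∞ := by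
    funext a
    split_ifs with h
    · exact klDiv_kernel_eq_lintegral κ η h
    · exact klDiv_of_not_ac h
  rw [key]
  exact Measurable.ite (Kernel.measurableSet_absolutelyContinuous κ η)
    (measurable_ofReal_klFun_rnDeriv κ η).lintegral_kernel_prod_right' measurable_const

/-- The conditional divergence as an integral. -/
theorem klDiv_compProd_right (μ : Measure α) [IsFiniteMeasure μ] (κ η : Kernel α β)
    [IsFiniteKernel κ] [IsFiniteKernel η] :
    klDiv (μ ⊗ₘ κ) (μ ⊗ₘ η) = ∫⁻ a, klDiv (κ a) (η a) ∂μ := by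
  by_cases h : ∀ᵐ a ∂μ, κ a ≪ η a
  · have hac : μ ⊗ₘ κ ≪ μ ⊗ₘ η := Measure.absolutelyContinuous_compProd_right_iff.2 h
    have hdens : μ ⊗ₘ κ = (μ ⊗ₘ η).withDensity fun p => κ.rnDeriv η p.1 p.2 := by
      have hκ : κ =ᵐ[μ] η.withDensity (κ.rnDeriv η) := by
        filter_upwards [h] with a ha
        exact (Kernel.withDensity_rnDeriv_eq ha).symm
      rw [Measure.compProd_congr hκ, Measure.compProd_withDensity (Kernel.measurable_rnDeriv κ η)]
    have hrn : (μ ⊗ₘ κ).rnDeriv (μ ⊗ₘ η) =ᵐ[μ ⊗ₘ η] fun p => κ.rnDeriv η p.1 p.2 := by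
      rw [hdens]
      exact Measure.rnDeriv_withDensity _ (Kernel.measurable_rnDeriv κ η)
    rw [klDiv_eq_lintegral_klFun_of_ac hac]
    calc ∫⁻ p, ENNReal.ofReal (klFun ((μ ⊗ₘ κ).rnDeriv (μ ⊗ₘ η) p).toReal) ∂(μ ⊗ₘ η)
      _ = ∫⁻ p, ENNReal.ofReal (klFun (κ.rnDeriv η p.1 p.2).toReal) ∂(μ ⊗ₘ η) := by
        refine lintegral_congr_ae ?_
        filter_upwards [hrn] with p hp
        rw [hp]
      _ = ∫⁻ a, ∫⁻ b, ENNReal.ofReal (klFun (κ.rnDeriv η a b).toReal) ∂(η a) ∂μ :=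
        Measure.lintegral_compProd (measurable_ofReal_klFun_rnDeriv κ η)
      _ = ∫⁻ a, klDiv (κ a) (η a) ∂μ := by
        refine lintegral_congr_ae ?_
        filter_upwards [h] with a ha
        exact (klDiv_kernel_eq_lintegral κ η ha).symm
  · rw [klDiv_of_not_ac fun hac => h (Measure.absolutelyContinuous_compProd_right_iff.1 hac)]
    -- A finite integral would make the divergence finite for almost every `a`, which forces `κ a ≪
    -- η a` there.
    by_contra hne
    refine h ?_
    filter_upwards [ae_lt_top (measurable_klDiv_kernel κ η) (Ne.symm hne)] with a ha
    exact (klDiv_ne_top_iff.1 ha.ne).1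

end Kernel

/-! ### Invariance of the divergence under recoding -/

section Map

variable {Ω α β : Type*} {mΩ : MeasurableSpace Ω} {mα : MeasurableSpace α}
  {mβ : MeasurableSpace β}

/-- Two random variables that are measurable functions of each other have laws with the same
divergences. -/
theorem klDiv_map_eq_of_comp (μ ν : Measure Ω) [IsFiniteMeasure μ] [IsFiniteMeasure ν]
    {X : Ω → α} {Y : Ω → β} (hX : Measurable X) (hY : Measurable Y) {f : α → β} {g : β → α}
    (hf : Measurable f) (hg : Measurable g) (hfX : f ∘ X = Y) (hgY : g ∘ Y = X) :
    klDiv (μ.map X) (ν.map X) = klDiv (μ.map Y) (ν.map Y) := by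
  -- Each law is an image of the other, so the data-processing inequality applies in both
  -- directions.
  refine le_antisymm ?_ ?_
  · rw [← hgY, ← Measure.map_map hg hY, ← Measure.map_map hg hY]
    exact klDiv_map_le _ _ hg
  · rw [← hfX, ← Measure.map_map hf hX, ← Measure.map_map hf hX]
    exact klDiv_map_le _ _ hf

/-- A measurable embedding has a measurable left inverse, so `X` and the identity are functions of
each other. -/
theorem klDiv_map_measurableEmbedding (μ ν : Measure Ω) [IsFiniteMeasure μ] [IsFiniteMeasure ν]
    [Nonempty Ω] {X : Ω → α} (hX : MeasurableEmbedding X) :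
    klDiv (μ.map X) (ν.map X) = klDiv μ ν := by
  obtain ⟨g, hg, hgX⟩ := hX.exists_measurable_extend measurable_id fun _ => ‹Nonempty Ω›
  simpa using klDiv_map_eq_of_comp μ ν hX.measurable measurable_id hg hX.measurable hgX
    (Function.comp_id X)

end Map

/-! ### Chain rule for conditional laws -/

section CondDistrib

variable {Ω α β γ : Type*} {mΩ : MeasurableSpace Ω} {mα : MeasurableSpace α}
  {mβ : MeasurableSpace β} {mγ : MeasurableSpace γ} [StandardBorelSpace β] [Nonempty β]

/-- The joint law of `X` and `Y`, if the conditional law of `Y` given `X` is a kernel evaluated at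
a function of `X`. -/
theorem map_prodMk_eq_compProd_comap (μ : Measure Ω) [IsFiniteMeasure μ] {X : Ω → α} {Y : Ω → β}
    (hX : Measurable X) (hY : Measurable Y) {g : α → γ} (hg : Measurable g) (κ : Kernel γ β)
    [IsFiniteKernel κ] (h : ∀ᵐ ω ∂μ, condDistrib Y X μ (X ω) = κ (g (X ω))) :
    μ.map (fun ω => (X ω, Y ω)) = μ.map X ⊗ₘ κ.comap g hg := by
  rw [← compProd_map_condDistrib hY.aemeasurable]
  ext s hs
  rw [Measure.compProd_apply hs, Measure.compProd_apply hs,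
    -- The kernels are known to agree only at the points `X ω`, so both integrals are pulled back to
    -- `Ω`.
    lintegral_map (Kernel.measurable_kernel_prodMk_left hs) hX,
    lintegral_map (Kernel.measurable_kernel_prodMk_left hs) hX]
  refine lintegral_congr_ae ?_
  filter_upwards [h] with ω hω
  rw [hω, Kernel.comap_apply]

/-- **Chain rule** for the divergence of the joint laws of `X` and `Y`, if under both measures the
conditional law of `Y` given `X` depends on `X` through the same function. -/
theorem klDiv_map_prodMk (μ ν : Measure Ω) [IsProbabilityMeasure μ] [IsProbabilityMeasure ν]
    [MeasurableSpace.CountableOrCountablyGenerated α β]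
    [MeasurableSpace.CountableOrCountablyGenerated γ β] {X : Ω → α} {Y : Ω → β}
    (hX : Measurable X) (hY : Measurable Y) {g : α → γ} (hg : Measurable g) (κ η : Kernel γ β)
    [IsMarkovKernel κ] [IsMarkovKernel η]
    (hμ : ∀ᵐ ω ∂μ, condDistrib Y X μ (X ω) = κ (g (X ω)))
    (hν : ∀ᵐ ω ∂ν, condDistrib Y X ν (X ω) = η (g (X ω))) :
    klDiv (μ.map fun ω => (X ω, Y ω)) (ν.map fun ω => (X ω, Y ω)) =
      klDiv (μ.map X) (ν.map X) + ∫⁻ z, klDiv (κ z) (η z) ∂(μ.map (g ∘ X)) := by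
  have := Measure.isProbabilityMeasure_map (μ := μ) hX.aemeasurable
  have := Measure.isProbabilityMeasure_map (μ := ν) hX.aemeasurable
  -- `η` is pinned down only `ν`-almost surely but is integrated under `μ`. This is harmless:
  -- without absolute continuity of the laws of `X`, both sides are `∞`.
  rw [map_prodMk_eq_compProd_comap μ hX hY hg κ hμ, map_prodMk_eq_compProd_comap ν hX hY hg η hν,
    klDiv_compProd_eq_add, klDiv_compProd_right, ← Measure.map_map hg hX,
    lintegral_map (measurable_klDiv_kernel κ η) hg]
  simp only [Kernel.comap_apply]

end CondDistrib

end InformationTheory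

/-! ### Paths on the tree and their edge processes -/

namespace RootedMetricTree

variable {V : Type*} {T : RootedMetricTree V} {d : ℕ}

/-- Compactness gives the path space its supremum metric. -/
instance [Finite V] : CompactSpace T.Realisation := by
  let _ : TopologicalSpace V := ⊥
  have : CompactSpace (V ⊕ (Σ e : T.DirEdge, e.Interval)) := inferInstance
  have : CompactSpace T.Pieces := this
  exact inferInstanceAs (CompactSpace (Quot T.Glue))

/-- Every vertex other than the root is entered by an edge. -/
theorem exists_tgt_eq (T : RootedMetricTree V) {v : V} (hv : v ≠ T.root) :
    ∃ e : T.DirEdge, e.tgt = v := by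
  -- The second vertex of a shortest walk to the root is one step closer to the root, so it is the
  -- source of the required edge.
  obtain ⟨p, hp⟩ := T.isTree.connected.exists_walk_length_eq_dist v T.root
  cases p with
  | nil => exact absurd rfl hv
  | @cons _ w _ h q =>
    have h1 : T.graph.dist w T.root ≤ q.length := SimpleGraph.dist_le q
    have h2 : T.graph.dist v T.root ≤ T.graph.dist v w + T.graph.dist w T.root :=
      T.isTree.connected.dist_triangle
    rw [SimpleGraph.dist_eq_one_iff_adj.2 h] at h2
    rw [SimpleGraph.Walk.length_cons] at hp
    refine ⟨⟨(w, v), h.symm, ?_⟩, rfl⟩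
    change T.graph.dist T.root v = T.graph.dist T.root w + 1
    rw [SimpleGraph.dist_comm (u := T.root), SimpleGraph.dist_comm (u := T.root)]
    omega

theorem edgeProcess_finish (e : T.DirEdge) (X : T.PathSpace d) :
    edgeProcess e X e.finish = vertexValue e.tgt X :=
  congrArg X (Quot.sound (Glue.tgt e)).symm

theorem measurable_vertexValue (v : V) :
    Measurable (vertexValue v : T.PathSpace d → EuclideanSpace ℝ (Fin d)) :=
  (continuous_eval_const (T.vertexPoint v)).measurable

theorem measurable_edgeProcess (e : T.DirEdge) :
    Measurable (edgeProcess e : T.PathSpace d → EdgePathSpace e d) :=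
  ((T.edgePath e).continuous_precomp).measurable

instance (P : Measure (T.PathSpace d)) [IsFiniteMeasure P] (e : T.DirEdge) :
    IsMarkovKernel (edgeKernel P e) :=
  inferInstanceAs (IsMarkovKernel (condDistrib (edgeProcess e) (vertexValue e.src) P))

variable {n : ℕ}

/-- The value at the root, together with the processes along the first `m` edges. -/
def pastUpTo (σ : Fin n ≃ T.DirEdge) (m : ℕ) (X : T.PathSpace d) :
    EuclideanSpace ℝ (Fin d) × (∀ j : {j : Fin n // (j : ℕ) < m}, EdgePathSpace (σ j) d) :=
  (vertexValue T.root X, fun j => edgeProcess (σ j) X)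

theorem measurable_pastUpTo (σ : Fin n ≃ T.DirEdge) (m : ℕ) :
    Measurable (pastUpTo σ m (d := d)) :=
  (measurable_vertexValue _).prodMk (measurable_pi_lambda _ fun _ => measurable_edgeProcess _)

/-- A path is determined by its value at the root and its processes along the edges, and so are
the distances between paths. -/
theorem isometry_pastUpTo [Finite V] (σ : Fin n ≃ T.DirEdge) :
    Isometry (pastUpTo σ n (d := d)) := by
  refine Isometry.of_dist_eq fun X Y => le_antisymm ?_ ?_
  · refine max_le (ContinuousMap.dist_apply_le_dist _) ?_
    refine (dist_pi_le_iff dist_nonneg).2 fun j => ?_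
    exact (ContinuousMap.dist_le dist_nonneg).2 fun t =>
      ContinuousMap.dist_apply_le_dist (f := X) (g := Y) (T.edgePath (σ j) t)
  · have hedge (e : T.DirEdge) (t : e.Interval) :
        dist (edgeProcess e X t) (edgeProcess e Y t) ≤ dist (pastUpTo σ n X) (pastUpTo σ n Y) := by
      obtain ⟨j, rfl⟩ := σ.surjective e
      calc dist (edgeProcess (σ j) X t) (edgeProcess (σ j) Y t)
        _ ≤ dist (edgeProcess (σ j) X) (edgeProcess (σ j) Y) :=
          ContinuousMap.dist_apply_le_dist _
        _ ≤ dist (pastUpTo σ n X).2 (pastUpTo σ n Y).2 :=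
          dist_le_pi_dist (pastUpTo σ n X).2 (pastUpTo σ n Y).2 ⟨j, j.2⟩
        _ ≤ _ := le_max_right _ _
    refine (ContinuousMap.dist_le dist_nonneg).2 fun x => ?_
    -- Every point of the tree is the root, the end of an edge, or a point on an edge.
    induction x using Quot.ind with | mk p => ?_
    rcases p with v | ⟨e, t⟩
    · change dist (vertexValue v X) (vertexValue v Y) ≤ _
      by_cases hv : v = T.root
      · subst hv
        exact le_max_left _ _
      · obtain ⟨e, rfl⟩ := T.exists_tgt_eq hv
        rw [← edgeProcess_finish, ← edgeProcess_finish]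
        exact hedge e _
    · exact hedge e t

/-- The path space is complete, so its isometric image is closed. -/
theorem measurableEmbedding_pastUpTo [Finite V] (σ : Fin n ≃ T.DirEdge) :
    MeasurableEmbedding (pastUpTo σ n (d := d)) :=
  (isometry_pastUpTo σ).isClosedEmbedding.measurableEmbedding

/-- In a traversal, the value at the starting vertex of an edge is a function of the past. -/
theorem IsTraversal.exists_vertexValue_src {σ : Fin n ≃ T.DirEdge} (hσ : IsTraversal σ)
    (k : Fin n) : ∃ g, Measurable g ∧
      g ∘ pastUpTo σ k (d := d) = vertexValue (σ k).src := by
  by_cases hv : (σ k).src = T.root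
  · refine ⟨Prod.fst, measurable_fst, ?_⟩
    rw [hv]
    rfl
  · obtain ⟨e, he⟩ := T.exists_tgt_eq hv
    obtain ⟨j, rfl⟩ := σ.surjective e
    -- The edge entering the source precedes edge `k`, so its final value can be read off the past.
    refine ⟨fun x => x.2 ⟨j, hσ j k he⟩ (σ j).finish, ?_, ?_⟩
    · exact (continuous_eval_const (σ j).finish).measurable.comp
        ((measurable_pi_apply _).comp measurable_snd)
    · funext X
      exact (edgeProcess_finish (σ j) X).trans (by rw [he])

theorem klDiv_map_pastUpTo_zero (σ : Fin n ≃ T.DirEdge) (P P' : Measure (T.PathSpace d))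
    [IsProbabilityMeasure P]
    (hroot : P.map (vertexValue T.root) = P'.map (vertexValue T.root)) :
    klDiv (P.map (pastUpTo σ 0)) (P'.map (pastUpTo σ 0)) = 0 := by
  let f : EuclideanSpace ℝ (Fin d) → EuclideanSpace ℝ (Fin d) ×
      (∀ j : {j : Fin n // (j : ℕ) < 0}, EdgePathSpace (σ j) d) :=
    fun x => (x, fun j => absurd j.2 (Nat.not_lt_zero _))
  have hf : Measurable f := measurable_id.prodMk measurable_const
  have hcomp : pastUpTo σ 0 = f ∘ vertexValue (d := d) T.root := by
    funext X
    exact Prod.ext rfl (funext fun j => absurd j.2 (Nat.not_lt_zero _))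
  rw [hcomp, ← Measure.map_map hf (measurable_vertexValue _),
    ← Measure.map_map hf (measurable_vertexValue _), hroot]
  have : IsFiniteMeasure (P'.map (vertexValue (d := d) T.root)) := hroot ▸ inferInstance
  exact le_antisymm ((klDiv_map_le _ _ hf).trans_eq (klDiv_self _)) zero_le

/-- The processes along the first `k + 1` edges carry the same information as those along the
first `k` edges together with that along the next edge. -/
theorem klDiv_map_pastUpTo_succ (σ : Fin n ≃ T.DirEdge) (k : Fin n)
    (P P' : Measure (T.PathSpace d)) [IsFiniteMeasure P] [IsFiniteMeasure P'] :
    klDiv (P.map (pastUpTo σ (k + 1))) (P'.map (pastUpTo σ (k + 1))) =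
      klDiv (P.map fun X => (pastUpTo σ k X, edgeProcess (σ k) X))
        (P'.map fun X => (pastUpTo σ k X, edgeProcess (σ k) X)) := by
  classical
  refine klDiv_map_eq_of_comp P P' (measurable_pastUpTo σ _)
    ((measurable_pastUpTo σ _).prodMk (measurable_edgeProcess _))
    (f := fun x => ((x.1, fun j => x.2 ⟨j.1, j.2.trans (Nat.lt_succ_self _)⟩),
      x.2 ⟨k, Nat.lt_succ_self _⟩))
    -- An index below `k + 1` but not below `k` equals `k`; the new process is transported along
    -- this equality because path spaces depend on the edge.
    (g := fun x => (x.1.1, fun j => if h : (j.1 : ℕ) < k then x.1.2 ⟨j.1, h⟩ else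
      (Fin.ext (by have := j.2; omega) : k = j.1) ▸ x.2)) ?_ ?_ rfl ?_
  · refine (measurable_fst.prodMk (measurable_pi_lambda _ fun j => ?_)).prodMk ?_
    · exact (measurable_pi_apply _).comp measurable_snd
    · exact (measurable_pi_apply (⟨k, Nat.lt_succ_self _⟩ : {j : Fin n // (j : ℕ) < k + 1})).comp
        measurable_snd
  · refine (measurable_fst.comp measurable_fst).prodMk (measurable_pi_lambda _ fun ⟨j, hj⟩ => ?_)
    by_cases h : (j : ℕ) < k
    · simp only [h, dite_true]
      exact (measurable_pi_apply _).comp (measurable_snd.comp measurable_fst)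
    · obtain rfl : k = j := Fin.ext (by omega)
      simpa only [h, dite_false] using measurable_snd
  · funext X
    refine Prod.ext rfl (funext fun ⟨j, hj⟩ => ?_)
    by_cases h : (j : ℕ) < k
    · simp only [Function.comp_apply, h, dite_true]
      rfl
    · obtain rfl : k = j := Fin.ext (by omega)
      simp only [Function.comp_apply, h, dite_false]
      rfl

theorem klDiv_map_pastUpTo_step {σ : Fin n ≃ T.DirEdge} (hσ : IsTraversal σ) (k : Fin n)
    (P P' : Measure (T.PathSpace d)) [IsProbabilityMeasure P] [IsProbabilityMeasure P']
    (hP : Factorises σ P) (hP' : Factorises σ P') :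
    klDiv (P.map (pastUpTo σ (k + 1))) (P'.map (pastUpTo σ (k + 1))) =
      klDiv (P.map (pastUpTo σ k)) (P'.map (pastUpTo σ k)) +
        ∫⁻ x, klDiv (edgeKernel P (σ k) x) (edgeKernel P' (σ k) x)
          ∂(P.map (vertexValue (σ k).src)) := by
  obtain ⟨g, hg, hgX⟩ := hσ.exists_vertexValue_src (d := d) k
  have hgX' (X : T.PathSpace d) : g (pastUpTo σ k X) = vertexValue (σ k).src X := congrFun hgX X
  rw [klDiv_map_pastUpTo_succ, klDiv_map_prodMk P P' (measurable_pastUpTo σ k)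
    (measurable_edgeProcess (σ k)) hg (edgeKernel P (σ k)) (edgeKernel P' (σ k)), hgX]
  · simp_rw [hgX']
    -- `past σ k` and `pastUpTo σ k` agree by definition, since the order on `Fin n` is that of the
    -- values.
    exact hP k
  · simp_rw [hgX']
    exact hP' k

theorem klDiv_map_pastUpTo {σ : Fin n ≃ T.DirEdge} (hσ : IsTraversal σ)
    (P P' : Measure (T.PathSpace d)) [IsProbabilityMeasure P] [IsProbabilityMeasure P']
    (hroot : P.map (vertexValue T.root) = P'.map (vertexValue T.root))
    (hP : Factorises σ P) (hP' : Factorises σ P') (m : ℕ) (hm : m ≤ n) :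
    klDiv (P.map (pastUpTo σ m)) (P'.map (pastUpTo σ m)) =
      ∑ k : Fin n with k.val < m,
        ∫⁻ x, klDiv (edgeKernel P (σ k) x) (edgeKernel P' (σ k) x)
          ∂(P.map (vertexValue (σ k).src)) := by
  induction m with
  | zero => simpa using klDiv_map_pastUpTo_zero σ P P' hroot
  | succ m ih =>
    have hfilter : Finset.univ.filter (fun k : Fin n => k.val < m + 1) =
        insert ⟨m, hm⟩ (Finset.univ.filter fun k : Fin n => k.val < m) := by
      ext k
      simp only [Finset.mem_filter, Finset.mem_univ, true_and, Finset.mem_insert, Fin.ext_iff]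
      omega
    rw [hfilter, Finset.sum_insert (by simp), ← ih (Nat.le_of_succ_le hm),
      add_comm (lintegral _ _)]
    exact klDiv_map_pastUpTo_step hσ ⟨m, hm⟩ P P' hP hP'

end RootedMetricTree

theorem mainTheorem7 {V : Type*} [Finite V] (T : RootedMetricTree V) (d : ℕ) {n : ℕ}
    (σ : Fin n ≃ T.DirEdge) (hσ : RootedMetricTree.IsTraversal σ)
    (P P' : Measure (T.PathSpace d)) [IsProbabilityMeasure P] [IsProbabilityMeasure P']
    (hroot : P.map (RootedMetricTree.vertexValue T.root) =
      P'.map (RootedMetricTree.vertexValue T.root))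
    (hP : RootedMetricTree.Factorises σ P) (hP' : RootedMetricTree.Factorises σ P') :
    (∀ e : T.DirEdge, Measurable fun x : EuclideanSpace ℝ (Fin d) =>
      klDiv (RootedMetricTree.edgeKernel P e x) (RootedMetricTree.edgeKernel P' e x)) ∧
    klDiv P P' = ∑ e : T.DirEdge,
      ∫⁻ x, klDiv (RootedMetricTree.edgeKernel P e x) (RootedMetricTree.edgeKernel P' e x)
        ∂(P.map (RootedMetricTree.vertexValue e.src)) := by
  have : Nonempty (T.PathSpace d) := ⟨0⟩
  refine ⟨fun e => measurable_klDiv_kernel _ _, ?_⟩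
  rw [← klDiv_map_measurableEmbedding P P' (RootedMetricTree.measurableEmbedding_pastUpTo σ),
    RootedMetricTree.klDiv_map_pastUpTo hσ P P' hroot hP hP' n le_rfl,
    Finset.filter_true_of_mem fun k _ => k.isLt]
  exact σ.sum_comp fun e => ∫⁻ x,
    klDiv (RootedMetricTree.edgeKernel P e x) (RootedMetricTree.edgeKernel P' e x)
      ∂(P.map (RootedMetricTree.vertexValue e.src))
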